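/- Let $\ell_1$ be the Banach space of absolutely summable sequences $x=(x_1,x_2,\dots)$ of scalars, the scalar field $\mathbb K$ being $\mathbb R$ or $\mathbb C$. Let $B_\omega:\ell_1\to\ell_1$ be the bounded weighted backward shift $$[B_\omega(x)]_i=\frac{x_{i+1}}{i^2}\qquad(i\ge 1),$$ and let $M:\ell_1\times\ell_1\to\ell_1$ be the bounded bilinear map $$M(x,y)=\frac{x_1B_\omega(y)+y_1B_\omega(x)}{2}.$$ For $x,y\in\ell_1$ put $M^0(x,y)=\{x,y\}$ and $M^{n}(x,y)=M^{n-1}(x,y)\cup\{M(z,w): z,w\in M^{n-1}(x,y)\}$ for $n\ge 1$; the orbit of $M$ with initial conditions $(x,y)$ is $\bigcup_{n\ge 0}M^n(x,y)$. Theorem. The map $M$ is symmetric and bihypercyclic: there are $x,y\in\ell_1$ such that the orbit $\bigcup_{n\ge0}M^n(x,y)$ is dense in $\ell_1$. -/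

import Mathlib

open scoped ENNReal

noncomputable section

namespace Bihypercyclic

section Orbits

variable {𝕜 X : Type*} [NontriviallyNormedField 𝕜] [NormedAddCommGroup X] [NormedSpace 𝕜 X]

/-- The `n`-states of a bounded bilinear map `M` with initial conditions `x, y`:
`M⁰(x,y) = {x, y}` and `Mⁿ⁺¹(x,y) = Mⁿ(x,y) ∪ {M(z,w) : z, w ∈ Mⁿ(x,y)}`. -/
def state (M : X →L[𝕜] X →L[𝕜] X) (x y : X) : ℕ → Set X
  | 0 => {x, y}
  | n + 1 => state M x y n ∪ {u | ∃ z ∈ state M x y n, ∃ w ∈ state M x y n, u = M z w}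

/-- The orbit of `M` with initial conditions `x, y`: the union of all the `n`-states. -/
def orbit (M : X →L[𝕜] X →L[𝕜] X) (x y : X) : Set X :=
  ⋃ n : ℕ, state M x y n

/-- A bounded bilinear map is bihypercyclic if one of its orbits is dense. -/
def IsBihypercyclic (M : X →L[𝕜] X →L[𝕜] X) : Prop :=
  ∃ x y : X, Dense (orbit M x y)

end Orbits

/-- The Banach space `ℓ₁` of absolutely summable scalar sequences. Sequences are indexed from `0`
here: the entry `x i` is the coordinate with number `i + 1` in the usual notation
`x = (x₁, x₂, …)`. -/
abbrev ellOne (𝕜 : Type*) [RCLike 𝕜] : Type _ := lp (fun _ : ℕ => 𝕜) 1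

variable (𝕜 : Type*) [RCLike 𝕜]

theorem ellOne_summable (x : ellOne 𝕜) : Summable fun i => ‖x i‖ := by
  simpa using (lp.memℓp x).summable (by simp)

theorem ellOne_norm (x : ellOne 𝕜) : ‖x‖ = ∑' i, ‖x i‖ := by
  simpa using lp.norm_eq_tsum_rpow (p := 1) (by simp) x

theorem norm_shift_le (x : ellOne 𝕜) (i : ℕ) :
    ‖x (i + 1) / ((i : 𝕜) + 1) ^ 2‖ ≤ ‖x (i + 1)‖ := by
  have h : ‖((i : 𝕜) + 1) ^ 2‖ = ((i : ℝ) + 1) ^ 2 := by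
    rw [norm_pow]
    congr 1
    exact_mod_cast RCLike.norm_natCast (K := 𝕜) (i + 1)
  rw [norm_div, h]
  refine div_le_self (norm_nonneg _) ?_
  have : (0 : ℝ) ≤ i := Nat.cast_nonneg i
  nlinarith

theorem summable_shift (x : ellOne 𝕜) :
    Summable fun i : ℕ => ‖x (i + 1) / ((i : 𝕜) + 1) ^ 2‖ :=
  Summable.of_nonneg_of_le (fun _ => norm_nonneg _) (norm_shift_le 𝕜 x)
    ((summable_nat_add_iff 1).2 (ellOne_summable 𝕜 x))

/-- The weighted backward shift `B_ω` on `ℓ₁` with weights `ω_i = 1 / i²`. In the indexing from `1`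
it is `[B_ω x]_i = x_{i+1} / i²`. -/
def weightedShift : ellOne 𝕜 →L[𝕜] ellOne 𝕜 :=
  LinearMap.mkContinuous
    { toFun := fun x => ⟨fun i : ℕ => x (i + 1) / ((i : 𝕜) + 1) ^ 2,
        memℓp_gen (by simpa using summable_shift 𝕜 x)⟩
      map_add' := fun x y => by
        ext i
        exact add_div _ _ _
      map_smul' := fun c x => by
        ext i
        exact mul_div_assoc _ _ _ }
    1 (fun x => by
      rw [one_mul, ellOne_norm, ellOne_norm]
      refine ((summable_shift 𝕜 x).tsum_le_tsum (norm_shift_le 𝕜 x)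
        ((summable_nat_add_iff 1).2 (ellOne_summable 𝕜 x))).trans ?_
      rw [(ellOne_summable 𝕜 x).tsum_eq_zero_add]
      exact le_add_of_nonneg_left (norm_nonneg _))

theorem weightedShift_apply (x : ellOne 𝕜) (i : ℕ) :
    weightedShift 𝕜 x i = x (i + 1) / ((i : 𝕜) + 1) ^ 2 := rfl

/-- The first coordinate functional `e₁'` on `ℓ₁`. -/
def firstCoord : ellOne 𝕜 →L[𝕜] 𝕜 :=
  LinearMap.mkContinuous
    { toFun := fun x => x 0
      map_add' := fun _ _ => rfl
      map_smul' := fun _ _ => rfl }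
    1 (fun x => by
      rw [one_mul]
      exact lp.norm_apply_le_norm (by simp) x 0)

theorem firstCoord_apply (x : ellOne 𝕜) : firstCoord 𝕜 x = x 0 := rfl

/-- The bounded bilinear map `(x, y) ↦ e₁'(x) B_ω(y)` on `ℓ₁`. -/
def coordShift : ellOne 𝕜 →L[𝕜] ellOne 𝕜 →L[𝕜] ellOne 𝕜 :=
  (ContinuousLinearMap.lsmul 𝕜 𝕜).bilinearComp (firstCoord 𝕜) (weightedShift 𝕜)

/-- The symmetric bounded bilinear map `M(x, y) = (e₁'(x) B_ω(y) + e₁'(y) B_ω(x)) / 2` on `ℓ₁`. -/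
def symShift : ellOne 𝕜 →L[𝕜] ellOne 𝕜 →L[𝕜] ellOne 𝕜 :=
  (2 : 𝕜)⁻¹ • (coordShift 𝕜 + (coordShift 𝕜).flip)

theorem symShift_apply (x y : ellOne 𝕜) :
    symShift 𝕜 x y =
      (2 : 𝕜)⁻¹ • (firstCoord 𝕜 x • weightedShift 𝕜 y + firstCoord 𝕜 y • weightedShift 𝕜 x) :=
  rfl

end Bihypercyclic

end

namespace Bihypercyclic

section Orbits

variable {𝕜 X : Type*} [NontriviallyNormedField 𝕜] [NormedAddCommGroup X] [NormedSpace 𝕜 X]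

/-! With e₁ the first unit vector, B_ω e₁ = 0, so M(c e₁, z) = (c/2) B_ω z. The seed y = (1/2, 4, 0,
…) puts every 2^(k+1) e₁ in the orbit, whatever x is; hence the orbit contains 2^m B_ω^(n+1) x for
all m, n (`two_pow_smul_weightedShift_pow_mem_orbit`). It remains to choose x so that these vectors
are dense. `exists_dense_two_pow_smul_pow` does this by Baire category, applied to the finitely
supported sequences: each is killed by a power of B_ω and has preimages under all powers. -/

theorem state_mono (M : X →L[𝕜] X →L[𝕜] X) (x y : X) : Monotone (state M x y) :=
  monotone_nat_of_le_succ fun _ => Set.subset_union_left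

theorem left_mem_orbit (M : X →L[𝕜] X →L[𝕜] X) (x y : X) : x ∈ orbit M x y :=
  Set.mem_iUnion.2 ⟨0, Or.inl rfl⟩

theorem right_mem_orbit (M : X →L[𝕜] X →L[𝕜] X) (x y : X) : y ∈ orbit M x y :=
  Set.mem_iUnion.2 ⟨0, Or.inr rfl⟩

theorem map_mem_orbit {M : X →L[𝕜] X →L[𝕜] X} {x y z w : X} (hz : z ∈ orbit M x y)
    (hw : w ∈ orbit M x y) : M z w ∈ orbit M x y := by
  obtain ⟨m, hm⟩ := Set.mem_iUnion.1 hz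
  obtain ⟨n, hn⟩ := Set.mem_iUnion.1 hw
  exact Set.mem_iUnion.2 ⟨max m n + 1, Or.inr ⟨z, state_mono M x y (le_max_left m n) hm,
    w, state_mono M x y (le_max_right m n) hn, rfl⟩⟩

end Orbits

/-- If the points annihilated by some power of `T` that lie in the range of every power of `T` are
dense, then some vector has a dense orbit under the powers of `T` scaled by powers of `2`. -/
theorem exists_dense_two_pow_smul_pow {𝕜 X : Type*} [RCLike 𝕜] [NormedAddCommGroup X]
    [NormedSpace 𝕜 X] [CompleteSpace X] [SecondCountableTopology X] (T : X →L[𝕜] X) {D : Set X}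
    (hD : Dense D) (hker : ∀ w ∈ D, ∃ n : ℕ, (T ^ n) w = 0)
    (hran : ∀ v ∈ D, ∀ n : ℕ, ∃ s, (T ^ n) s = v) :
    ∃ x : X, Dense {u | ∃ m n : ℕ, u = (2 : 𝕜) ^ m • (T ^ (n + 1)) x} := by
  obtain ⟨b, hbc, hb0, hb⟩ := TopologicalSpace.exists_countable_basis X
  let G (U : Set X) : Set X := ⋃ m : ℕ, ⋃ n : ℕ, {x | (2 : 𝕜) ^ m • (T ^ (n + 1)) x ∈ U}
  have hGo : ∀ U ∈ b, IsOpen (G U) := fun U hU =>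
    isOpen_iUnion fun m => isOpen_iUnion fun n =>
      (hb.isOpen hU).preimage ((T ^ (n + 1)).continuous.const_smul _)
  have hGd : ∀ U ∈ b, Dense (G U) := by
    intro U hU
    obtain ⟨v, hvU, hvD⟩ := hD.inter_open_nonempty U (hb.isOpen hU)
      (Set.nonempty_iff_ne_empty.2 fun h => hb0 (h ▸ hU))
    refine dense_iff_inter_open.2 fun V hV hVne => ?_
    obtain ⟨w, hwV, hwD⟩ := hD.inter_open_nonempty V hV hVne
    obtain ⟨n, hn⟩ := hker w hwD
    obtain ⟨s, hs⟩ := hran v hvD (n + 1)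
    -- Perturbing w by 2^(-m) s keeps it in V for large m, while 2^m T^(n+1) kills w and sends the
    -- perturbation exactly to v.
    have hlim : Filter.Tendsto (fun m : ℕ => w + ((2 : 𝕜)⁻¹ ^ m) • s) Filter.atTop (nhds w) := by
      have h0 := tendsto_pow_atTop_nhds_zero_of_norm_lt_one (x := (2 : 𝕜)⁻¹) (by norm_num)
      simpa using (h0.smul_const s).const_add w
    obtain ⟨m, hm⟩ := (hlim.eventually (hV.mem_nhds hwV)).exists
    refine ⟨_, hm, Set.mem_iUnion.2 ⟨m, Set.mem_iUnion.2 ⟨n, ?_⟩⟩⟩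
    have hw : (T ^ (n + 1)) w = 0 := by rw [pow_succ', mul_apply_eq_comp, hn, map_zero]
    have h2 : (2 : 𝕜) ^ m * (2 : 𝕜)⁻¹ ^ m = 1 := by
      rw [← mul_pow, mul_inv_cancel₀ two_ne_zero, one_pow]
    rw [Set.mem_ofPred_eq, map_add, hw, zero_add, map_smul, hs, smul_smul, h2, one_smul]
    exact hvU
  -- Baire: a single x visits every basic open set.
  obtain ⟨x, hx⟩ := (dense_biInter_of_isOpen hGo hbc hGd).nonempty
  refine ⟨x, hb.dense_iff.2 fun U hU _ => ?_⟩
  obtain ⟨m, hm⟩ := Set.mem_iUnion.1 (Set.mem_iInter₂.1 hx U hU)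
  obtain ⟨n, hn⟩ := Set.mem_iUnion.1 hm
  exact ⟨_, hn, m, n, rfl⟩

variable (𝕜 : Type*) [RCLike 𝕜]

/-- The unit vectors of `ℓ₁`. -/
noncomputable def unitVec (i : ℕ) : ellOne 𝕜 := lp.single 1 i (1 : 𝕜)

theorem unitVec_apply (i j : ℕ) : unitVec 𝕜 i j = if j = i then 1 else 0 := by
  simp [unitVec, lp.single_apply, Pi.single_apply]

theorem weightedShift_unitVec_zero : weightedShift 𝕜 (unitVec 𝕜 0) = 0 := by
  ext i
  simp [weightedShift_apply, unitVec_apply]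

theorem weightedShift_unitVec_succ (i : ℕ) :
    weightedShift 𝕜 (unitVec 𝕜 (i + 1)) = (((i : 𝕜) + 1) ^ 2)⁻¹ • unitVec 𝕜 i := by
  ext j
  by_cases h : j = i
  · simp [weightedShift_apply, unitVec_apply, h]
  · simp [weightedShift_apply, unitVec_apply, h]

theorem dense_span_unitVec : Dense (Submodule.span 𝕜 (Set.range (unitVec 𝕜)) : Set (ellOne 𝕜)) := by
  intro x
  refine mem_closure_of_tendsto (lp.hasSum_single ENNReal.one_ne_top x)
    (Filter.Eventually.of_forall fun s => Submodule.sum_mem _ fun i _ => ?_)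
  have h : lp.single 1 i (x i) = x i • unitVec 𝕜 i := by
    rw [unitVec, ← lp.single_smul, smul_eq_mul, mul_one]
  rw [h]
  exact Submodule.smul_mem _ _ (Submodule.subset_span ⟨i, rfl⟩)

theorem secondCountableTopology_ellOne : SecondCountableTopology (ellOne 𝕜) := by
  have h : TopologicalSpace.IsSeparable
      (Submodule.span 𝕜 (Set.range (unitVec 𝕜)) : Set (ellOne 𝕜)) :=
    (Set.countable_range _).isSeparable.span
  have h' := h.closure
  rw [(dense_span_unitVec 𝕜).closure_eq] at h'
  have := TopologicalSpace.isSeparable_univ_iff.1 h'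
  exact UniformSpace.secondCountable_of_separable _

theorem exists_weightedShift_pow_eq_zero (w : ellOne 𝕜)
    (hw : w ∈ Submodule.span 𝕜 (Set.range (unitVec 𝕜))) :
    ∃ n : ℕ, (weightedShift 𝕜 ^ n) w = 0 := by
  induction hw using Submodule.span_induction with
  | mem w hw =>
    obtain ⟨i, rfl⟩ := hw
    refine ⟨i + 1, ?_⟩
    induction i with
    | zero => simpa using weightedShift_unitVec_zero 𝕜
    | succ i ih =>
      rw [pow_succ, mul_apply_eq_comp, weightedShift_unitVec_succ, map_smul, ih,
        smul_zero]
  | zero => exact ⟨0, map_zero _⟩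
  | add u v _ _ hu hv =>
    obtain ⟨m, hm⟩ := hu
    obtain ⟨n, hn⟩ := hv
    refine ⟨m + n, ?_⟩
    rw [map_add, pow_add, mul_apply_eq_comp, mul_apply_eq_comp, hn,
      ← mul_apply_eq_comp, ← pow_add, add_comm m n, pow_add,
      mul_apply_eq_comp, hm]
    simp
  | smul c u _ hu =>
    obtain ⟨n, hn⟩ := hu
    exact ⟨n, by rw [map_smul, hn, smul_zero]⟩

/-- All weights are nonzero, so each unit vector is the image of a multiple of the next one. -/
theorem exists_weightedShift_pow_eq (v : ellOne 𝕜)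
    (hv : v ∈ Submodule.span 𝕜 (Set.range (unitVec 𝕜))) (n : ℕ) :
    ∃ s, (weightedShift 𝕜 ^ n) s = v := by
  induction hv using Submodule.span_induction with
  | mem v hv =>
    obtain ⟨i, rfl⟩ := hv
    induction n generalizing i with
    | zero => exact ⟨_, rfl⟩
    | succ n ih =>
      obtain ⟨s, hs⟩ := ih (i + 1)
      refine ⟨((i : 𝕜) + 1) ^ 2 • s, ?_⟩
      rw [pow_succ', mul_apply_eq_comp, map_smul, hs, map_smul,
        weightedShift_unitVec_succ, smul_smul, mul_inv_cancel₀, one_smul]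
      exact pow_ne_zero _ (Nat.cast_add_one_ne_zero i)
  | zero => exact ⟨0, map_zero _⟩
  | add u v _ _ hu hv =>
    obtain ⟨s, hs⟩ := hu
    obtain ⟨t, ht⟩ := hv
    exact ⟨s + t, by rw [map_add, hs, ht]⟩
  | smul c u _ hu =>
    obtain ⟨s, hs⟩ := hu
    exact ⟨c • s, by rw [map_smul, hs]⟩

/-- The vector `(1/2, 4, 0, 0, …)`, whose products under `symShift` contain arbitrarily large
multiples of the first unit vector. -/
noncomputable def seedVec : ellOne 𝕜 := (2 : 𝕜)⁻¹ • unitVec 𝕜 0 + (4 : 𝕜) • unitVec 𝕜 1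

theorem firstCoord_seedVec : firstCoord 𝕜 (seedVec 𝕜) = (2 : 𝕜)⁻¹ := by
  rw [seedVec, map_add, map_smul, map_smul]
  simp [firstCoord_apply, unitVec_apply]

theorem weightedShift_seedVec : weightedShift 𝕜 (seedVec 𝕜) = (4 : 𝕜) • unitVec 𝕜 0 := by
  have h := weightedShift_unitVec_succ 𝕜 0
  simp only [zero_add, Nat.cast_zero, one_pow, inv_one, one_smul] at h
  rw [seedVec, map_add, map_smul, map_smul, weightedShift_unitVec_zero, h, smul_zero, zero_add]

theorem symShift_smul_unitVec_zero (c : 𝕜) (z : ellOne 𝕜) :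
    symShift 𝕜 (c • unitVec 𝕜 0) z = (2⁻¹ * c) • weightedShift 𝕜 z := by
  have h : firstCoord 𝕜 (unitVec 𝕜 0) = 1 := by simp [firstCoord_apply, unitVec_apply]
  rw [symShift_apply, map_smul, map_smul, h, weightedShift_unitVec_zero, smul_zero, smul_zero,
    add_zero, smul_eq_mul, mul_one, smul_smul]

/-- Since B_ω y = 4e₁ and y₁ = 1/2, M(y, y) = 2e₁; each further product with y doubles the multiple:
M(c e₁, y) = 2c e₁. -/
theorem two_pow_smul_unitVec_mem_orbit (x : ellOne 𝕜) (k : ℕ) :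
    (2 : 𝕜) ^ (k + 1) • unitVec 𝕜 0 ∈ orbit (symShift 𝕜) x (seedVec 𝕜) := by
  have hy := right_mem_orbit (symShift 𝕜) x (seedVec 𝕜)
  induction k with
  | zero =>
    convert map_mem_orbit hy hy using 1
    rw [symShift_apply, firstCoord_seedVec, weightedShift_seedVec, smul_smul, ← add_smul, smul_smul]
    congr 1
    norm_num
  | succ k ih =>
    convert map_mem_orbit ih hy using 1
    rw [symShift_smul_unitVec_zero, weightedShift_seedVec, smul_smul]
    congr 1
    ring

theorem two_pow_smul_weightedShift_mem_orbit {x z : ellOne 𝕜}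
    (hz : z ∈ orbit (symShift 𝕜) x (seedVec 𝕜)) (m : ℕ) :
    (2 : 𝕜) ^ m • weightedShift 𝕜 z ∈ orbit (symShift 𝕜) x (seedVec 𝕜) := by
  -- The extra factor 2 in 2^(m+1) e₁ cancels the 1/2 in M, so m = 0 gives B_ω z itself.
  convert map_mem_orbit (two_pow_smul_unitVec_mem_orbit 𝕜 x m) hz using 1
  rw [symShift_smul_unitVec_zero, pow_succ', inv_mul_cancel_left₀ two_ne_zero]

theorem two_pow_smul_weightedShift_pow_mem_orbit (x : ellOne 𝕜) (m n : ℕ) :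
    (2 : 𝕜) ^ m • (weightedShift 𝕜 ^ (n + 1)) x ∈ orbit (symShift 𝕜) x (seedVec 𝕜) := by
  have h : (weightedShift 𝕜 ^ n) x ∈ orbit (symShift 𝕜) x (seedVec 𝕜) := by
    induction n with
    | zero => exact left_mem_orbit _ _ _
    | succ n ih =>
      rw [pow_succ', mul_apply_eq_comp]
      simpa using two_pow_smul_weightedShift_mem_orbit 𝕜 ih 0
  rw [pow_succ', mul_apply_eq_comp]
  exact two_pow_smul_weightedShift_mem_orbit 𝕜 h m

theorem isBihypercyclic_symShift : IsBihypercyclic (symShift 𝕜) := by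
  have := secondCountableTopology_ellOne 𝕜
  obtain ⟨x, hx⟩ := exists_dense_two_pow_smul_pow (weightedShift 𝕜) (dense_span_unitVec 𝕜)
    (exists_weightedShift_pow_eq_zero 𝕜) (exists_weightedShift_pow_eq 𝕜)
  refine ⟨x, seedVec 𝕜, hx.mono ?_⟩
  rintro _ ⟨m, n, rfl⟩
  exact two_pow_smul_weightedShift_pow_mem_orbit 𝕜 x m n

end Bihypercyclic

/-- Over the real and over the complex scalars, the bounded bilinear map
`M(x, y) = (x₁ B_ω(y) + y₁ B_ω(x)) / 2` on `ℓ₁` is symmetric and bihypercyclic. -/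
theorem mainTheorem5 (𝕜 : Type*) [RCLike 𝕜] :
    (∀ x y : Bihypercyclic.ellOne 𝕜,
      Bihypercyclic.symShift 𝕜 x y = Bihypercyclic.symShift 𝕜 y x) ∧
    Bihypercyclic.IsBihypercyclic (Bihypercyclic.symShift 𝕜) := by
  refine ⟨fun x y => ?_, Bihypercyclic.isBihypercyclic_symShift 𝕜⟩
  rw [Bihypercyclic.symShift_apply, Bihypercyclic.symShift_apply, add_comm]
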